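/- **Setting.** A *normal factored structure* consists of a state space $\mathcal S=\prod_{i=1}^m\mathcal X_i$ and an action space $\mathcal A=\prod_{i=m+1}^{n}\mathcal X_i$ with nonempty finite components $\mathcal X_1,\dots,\mathcal X_n$, transition scopes $Z_1^P,\dots,Z_m^P\subset[n]$ and reward scopes $Z_1^R,\dots,Z_l^R\subset[n]$. For $I\subset[n]$ and $x=(s,a)\in\mathcal X=\mathcal S\times\mathcal A$, let $x[I]=(x_i)_{i\in I}$ and $X[I]=\prod_{i\in I}|\mathcal X_i|$. An *FMDP* with this structure and horizon $H$ is given by stationary transitions $P(s'\mid x)=\prod_{i=1}^m P_i(s'[i]\mid x[Z_i^P])$ and by random rewards $r=\sum_{i=1}^l r_i\in[0,1]$, where $r_1,\dots,r_l\ge 0$ are independent given $x$, the law of $r_i$ depends only on $x[Z_i^R]$, and the rewards are independent of the next state given $x$. A (stochastic) policy $\pi$ assigns a distribution on $\mathcal A$ to each state and step $h\in[H]$; $V_1^\pi(s)$ is the expected total reward of an $H$-step episode started at $s$ under $\pi$, and $V_1^*(s)=\sup_\pi V_1^\pi(s)$. An *algorithm* (possibly randomized) knows the structure and $H$ but neither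 the transitions nor the rewards; it chooses the policy $\pi_k$ of the $k$-th episode from the policies, states, actions and factored rewards of the previous episodes and the initial state $s_{k,1}$. Over $K$ episodes ($T=KH$ steps), the regret is $\sum_{k=1}^K\bigl(V_1^*(s_{k,1})-V_1^{\pi_k}(s_{k,1})\bigr)$. **Theorem.** There is an absolute constant $c>0$ such that the following holds. Consider a normal factored structure with $Z_i^P\subset[m]$ for all $i\in[m]$ and arbitrary reward scopes, and let $Z_i^{R\prime}=Z_i^R\cap\{m+1,\dots,n\}$ be the action part of the $i$-th reward scope. Assume that $X[Z_i^{R\prime}]\ge 2$ for at least one $i\in[l]$. Then for every horizon $H$, every algorithm and every number $K$ of episodes with $T=KH\ge\max_{i}X[Z_i^{R\prime}]$, there are an FMDP with this structure and horizon and a sequence of initial states for which the expected regret of the algorithm over $K$ episodes is at least $$c\,\max_{i\in[l]}\sqrt{X[Z_i^{R\prime}]\,T}.$$ -/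

import Mathlib

open MeasureTheory ProbabilityTheory

universe u

noncomputable section

namespace FactoredMDP

/-! ### Factored structures -/

/-- A normal factored structure. There are `m` state components and `d = n - m` action components,
indexed by `Fin m` and `Fin d`; the `n` components of the state-action space are indexed by
`Fin m ⊕ Fin d`, so that the first `m` of them are the state components and the others are the
action components. All components are nonempty finite sets. `transScope i` and `rewardScope i` are
the scope index sets of the `i`-th transition factor and of the `i`-th reward factor. -/
structure NormalStructure where
  m : ℕ
  d : ℕ
  l : ℕ
  X : Fin m ⊕ Fin d → Type u
  fintypeX : ∀ i, Fintype (X i)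
  nonemptyX : ∀ i, Nonempty (X i)
  transScope : Fin m → Finset (Fin m ⊕ Fin d)
  rewardScope : Fin l → Finset (Fin m ⊕ Fin d)

namespace NormalStructure

variable (F : NormalStructure.{u})

instance (i : Fin F.m ⊕ Fin F.d) : Fintype (F.X i) := F.fintypeX i

instance (i : Fin F.m ⊕ Fin F.d) : Nonempty (F.X i) := F.nonemptyX i

/-- The state space, the product of the state components. -/
def State : Type u := ∀ i : Fin F.m, F.X (Sum.inl i)

/-- The action space, the product of the action components. -/
def Action : Type u := ∀ j : Fin F.d, F.X (Sum.inr j)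

instance : Fintype F.State := by
  classical
  exact inferInstanceAs (Fintype (∀ i : Fin F.m, F.X (Sum.inl i)))

instance : Fintype F.Action := by
  classical
  exact inferInstanceAs (Fintype (∀ j : Fin F.d, F.X (Sum.inr j)))

instance : Nonempty F.State := inferInstanceAs (Nonempty (∀ i : Fin F.m, F.X (Sum.inl i)))

instance : Nonempty F.Action := inferInstanceAs (Nonempty (∀ j : Fin F.d, F.X (Sum.inr j)))

instance : MeasurableSpace F.State := ⊤

instance : MeasurableSpace F.Action := ⊤

instance : DiscreteMeasurableSpace F.State := ⟨fun _ => trivial⟩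

instance : DiscreteMeasurableSpace F.Action := ⟨fun _ => trivial⟩

/-- The scope operation: the product of the components of the state-action space in `I`. -/
abbrev Scope (I : Finset (Fin F.m ⊕ Fin F.d)) : Type u := ∀ i : I, F.X i

/-- The size `X[I]` of the scope `I`. -/
def scopeCard (I : Finset (Fin F.m ⊕ Fin F.d)) : ℕ := Nat.card (F.Scope I)

/-- The action part of the `i`-th reward scope. -/
def actionPart (i : Fin F.l) : Finset (Fin F.m ⊕ Fin F.d) :=
  (F.rewardScope i).filter fun j => j.isRight = true

variable {F}

/-- The scope variable `x[I]` of the state-action pair `x = (s, a)`. -/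
def proj (I : Finset (Fin F.m ⊕ Fin F.d)) (x : F.State × F.Action) : F.Scope I :=
  fun i => Sum.rec (motive := fun j => F.X j) x.1 x.2 (i : Fin F.m ⊕ Fin F.d)

end NormalStructure

open NormalStructure

/-! ### Factored MDPs -/

/-- The (stationary) transition factors and reward factors of an FMDP with factored structure `F`.
`trans i z` is the distribution of the next `i`-th state component and `reward i z` is the law of
the `i`-th random reward, when `z` is the value of the respective scope variable. Given the
state-action pair, the `l` rewards are independent, they are nonnegative, and the total reward lies
in `[0, 1]`. -/
structure FMDP (F : NormalStructure.{u}) where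
  trans : ∀ i : Fin F.m, F.Scope (F.transScope i) → stdSimplex ℝ (F.X (Sum.inl i))
  reward : ∀ i : Fin F.l, F.Scope (F.rewardScope i) → ProbabilityMeasure ℝ
  reward_mem : ∀ x : F.State × F.Action,
    ∀ᵐ r ∂(Measure.pi fun i => (reward i (proj (F.rewardScope i) x) : Measure ℝ)),
      (∀ i, 0 ≤ r i) ∧ ∑ i, r i ≤ 1

variable {F : NormalStructure.{u}}

/-- A sample from a point of the probability simplex, as a Markov kernel. -/
def simplexKernel (α : Type*) [Fintype α] [MeasurableSpace α] : Kernel (stdSimplex ℝ α) α where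
  toFun p := ∑ a, ENNReal.ofReal (p.1 a) • Measure.dirac a
  measurable' := by
    refine Measure.measurable_of_measurable_coe _ fun s hs => ?_
    simp only [Measure.finsetSum_apply, Measure.smul_apply, smul_eq_mul]
    refine Finset.measurable_sum _ fun a _ => ?_
    exact (ENNReal.measurable_ofReal.comp
      ((measurable_pi_apply a).comp measurable_subtype_coe)).mul_const _

instance (α : Type*) [Fintype α] [MeasurableSpace α] : IsMarkovKernel (simplexKernel α) where
  isProbabilityMeasure p := ⟨by
    change (∑ a, ENNReal.ofReal (p.1 a) • Measure.dirac a : Measure α) Set.univ = 1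
    simp only [Measure.finsetSum_apply, Measure.smul_apply, smul_eq_mul, measure_univ, mul_one]
    rw [← ENNReal.ofReal_sum_of_nonneg (fun a _ => p.2.1 a), p.2.2, ENNReal.ofReal_one]⟩

/-- The transition probabilities: `P(s' | x)` is the product of the `P_i(s'[i] | x[Z_i^P])`. -/
def FMDP.transition (M : FMDP F) (x : F.State × F.Action) : stdSimplex ℝ F.State :=
  ⟨fun s' => ∏ i, (M.trans i (proj (F.transScope i) x)).1 (s' i),
    fun s' => Finset.prod_nonneg fun i _ => (M.trans i _).2.1 (s' i), by
      classical
      have h := Finset.prod_univ_sum (fun i : Fin F.m => (Finset.univ : Finset (F.X (Sum.inl i))))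
        (fun i a => (M.trans i (proj (F.transScope i) x)).1 a)
      rw [Finset.prod_eq_one fun i _ => (M.trans i _).2.2, Fintype.piFinset_univ] at h
      rw [h]
      exact Fintype.sum_equiv (Equiv.refl _) _ _ fun _ => rfl⟩

/-- The next state, given the state-action pair. -/
def FMDP.transitionKernel (M : FMDP F) : Kernel (F.State × F.Action) F.State :=
  (simplexKernel F.State).comap M.transition .of_discrete

instance (M : FMDP F) : IsMarkovKernel M.transitionKernel := by
  unfold FMDP.transitionKernel; infer_instance

/-- The vector of the `l` independent factored rewards, given the state-action pair. -/
def FMDP.rewardKernel (M : FMDP F) : Kernel (F.State × F.Action) (Fin F.l → ℝ) where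
  toFun x := Measure.pi fun i => (M.reward i (proj (F.rewardScope i) x) : Measure ℝ)
  measurable' := .of_discrete

instance (M : FMDP F) : IsMarkovKernel M.rewardKernel where
  isProbabilityMeasure x := by
    change IsProbabilityMeasure
      (Measure.pi fun i => (M.reward i (proj (F.rewardScope i) x) : Measure ℝ))
    infer_instance

/-! ### Policies, episodes and values -/

/-- A stochastic policy for `H` steps: a distribution over actions for each step and state. -/
abbrev Policy (F : NormalStructure.{u}) (H : ℕ) : Type u :=
  Fin H → F.State → stdSimplex ℝ F.Action

/-- What is observed in one step: the state, the action, the factored rewards, the next state. -/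
abbrev Step (F : NormalStructure.{u}) : Type u :=
  (F.State × F.Action) × ((Fin F.l → ℝ) × F.State)

/-- The observations of an episode of `H` steps. -/
abbrev Episode (F : NormalStructure.{u}) (H : ℕ) : Type u := Fin H → Step F

/-- The state `s` and an action drawn by the policy at its first step. -/
def actionKernel (F : NormalStructure.{u}) (H : ℕ) :
    Kernel (Policy F (H + 1) × F.State) (F.State × F.Action) :=
  (Kernel.deterministic Prod.snd measurable_snd) ×ₖ
    ((simplexKernel F.Action).comap (fun q : Policy F (H + 1) × F.State => q.1 0 q.2)
      (measurable_from_prod_countable_left fun s =>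
        (measurable_pi_apply s).comp (measurable_pi_apply (0 : Fin (H + 1)))))

instance (H : ℕ) : IsMarkovKernel (actionKernel F H) := by
  unfold actionKernel; infer_instance

/-- The first step of an episode, given the policy and the initial state. Given the state and the
action, the rewards and the next state are independent. -/
def FMDP.stepKernel (M : FMDP F) (H : ℕ) : Kernel (Policy F (H + 1) × F.State) (Step F) :=
  actionKernel F H ⊗ₖ
    (M.rewardKernel ×ₖ M.transitionKernel).comap Prod.snd measurable_snd

instance (M : FMDP F) (H : ℕ) : IsMarkovKernel (M.stepKernel H) := by
  unfold FMDP.stepKernel; infer_instance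

/-- The law of an episode of `H` steps, given the policy and the initial state: the first step is
followed by an episode of `H - 1` steps, which starts in the next state and uses the rest of the
policy. -/
def FMDP.episodeKernel (M : FMDP F) : (H : ℕ) → Kernel (Policy F H × F.State) (Episode F H)
  | 0 => Kernel.const _ (Measure.dirac Fin.elim0)
  | H + 1 =>
    (M.stepKernel H ⊗ₖ
      (M.episodeKernel H).comap
        (fun q : (Policy F (H + 1) × F.State) × Step F =>
          ((fun h => q.1.1 h.succ, q.2.2.2) : Policy F H × F.State)) (by fun_prop)).map
      (fun e : Step F × Episode F H => (Fin.cons e.1 e.2 : Episode F (H + 1)))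

theorem measurable_cons (H : ℕ) :
    Measurable fun e : Step F × Episode F H => (Fin.cons e.1 e.2 : Episode F (H + 1)) := by
  refine measurable_pi_lambda _ fun h => ?_
  refine Fin.cases ?_ (fun h => ?_) h
  · exact measurable_fst
  · exact (measurable_pi_apply h).comp measurable_snd

theorem measurable_snoc (α : Type*) [MeasurableSpace α] (k : ℕ) :
    Measurable fun e : (Fin k → α) × α => (Fin.snoc e.1 e.2 : Fin (k + 1) → α) := by
  refine measurable_pi_lambda _ fun h => ?_
  refine Fin.lastCases ?_ (fun h => ?_) h
  · simpa using measurable_snd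
  · simpa [Function.comp_def] using (measurable_pi_apply h).comp measurable_fst

instance FMDP.isMarkovKernel_episodeKernel (M : FMDP F) (H : ℕ) :
    IsMarkovKernel (M.episodeKernel H) := by
  induction H with
  | zero => unfold FMDP.episodeKernel; infer_instance
  | succ H ih => unfold FMDP.episodeKernel; exact Kernel.IsMarkovKernel.map _ (measurable_cons H)

/-- The value `V_1^π(s)`: the expected total reward in an episode of `H` steps from `s`. -/
def FMDP.value (M : FMDP F) {H : ℕ} (π : Policy F H) (s : F.State) : ℝ :=
  ∫ e, ∑ h, ∑ i, (e h).2.1 i ∂(M.episodeKernel H (π, s))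

/-- The optimal value `V_1^*(s)`. -/
def FMDP.optValue (M : FMDP F) (H : ℕ) (s : F.State) : ℝ := ⨆ π : Policy F H, M.value π s

/-! ### Algorithms and regret -/

/-- The record of `k` episodes: the policy and the observations of each. -/
abbrev History (F : NormalStructure.{u}) (H k : ℕ) : Type u := Fin k → Policy F H × Episode F H

/-- A (possibly randomized) algorithm: it selects the policy of an episode from the record of the
earlier episodes and the initial state of the episode. It does not depend on the FMDP, whose
transition and reward factors are unknown. -/
structure Algorithm (F : NormalStructure.{u}) (H : ℕ) where
  select : (k : ℕ) → Kernel (History F H k × F.State) (Policy F H)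
  isMarkovKernel_select : ∀ k, IsMarkovKernel (select k)

instance {H : ℕ} (alg : Algorithm F H) (k : ℕ) : IsMarkovKernel (alg.select k) :=
  alg.isMarkovKernel_select k

/-- The policy and the observations of the next episode, given the record of the earlier ones,
if the episode starts in `s`. -/
def Algorithm.nextKernel {H : ℕ} (alg : Algorithm F H) (M : FMDP F) (s : F.State) (k : ℕ) :
    Kernel (History F H k) (Policy F H × Episode F H) :=
  ((alg.select k).comap (fun η : History F H k => (η, s)) (by fun_prop)) ⊗ₖ
    ((M.episodeKernel H).comap (fun q : History F H k × Policy F H => (q.2, s)) (by fun_prop))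

instance {H : ℕ} (alg : Algorithm F H) (M : FMDP F) (s : F.State) (k : ℕ) :
    IsMarkovKernel (alg.nextKernel M s k) := by
  unfold Algorithm.nextKernel; infer_instance

/-- The law of the record of `K` episodes if the `k`-th one (counted from `0`) starts in `s k`. -/
def Algorithm.law {H : ℕ} (alg : Algorithm F H) (M : FMDP F) (s : ℕ → F.State) :
    (K : ℕ) → Measure (History F H K)
  | 0 => Measure.dirac Fin.elim0
  | K + 1 => ((alg.law M s K) ⊗ₘ (alg.nextKernel M (s K) K)).map
      (fun e => (Fin.snoc e.1 e.2 : History F H (K + 1)))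

instance Algorithm.isProbabilityMeasure_law {H : ℕ} (alg : Algorithm F H) (M : FMDP F)
    (s : ℕ → F.State) (K : ℕ) : IsProbabilityMeasure (alg.law M s K) := by
  induction K with
  | zero => unfold Algorithm.law; infer_instance
  | succ K ih =>
    unfold Algorithm.law
    exact Measure.isProbabilityMeasure_map (measurable_snoc _ K).aemeasurable

/-- The regret over `K` episodes, `∑ k, (V_1^*(s k) - V_1^{π k}(s k))`. -/
def FMDP.regret (M : FMDP F) {H : ℕ} (s : ℕ → F.State) {K : ℕ} (η : History F H K) : ℝ :=
  ∑ k : Fin K, (M.optValue H (s k) - M.value (η k).1 (s k))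

/-- The expected regret over `K` episodes. -/
def Algorithm.expectedRegret {H : ℕ} (alg : Algorithm F H) (M : FMDP F) (s : ℕ → F.State)
    (K : ℕ) : ℝ :=
  ∫ η, M.regret s η ∂(alg.law M s K)

end FactoredMDP

end

noncomputable section

namespace FactoredMDP

open NormalStructure

open scoped ENNReal

variable {F : NormalStructure.{u}}

/-! The hard instances are multi-armed bandits in disguise. Take the reward factor `i` whose scope
has the largest action part, with `A` values. Let the next state always be `s₀`, start every episode
there, and let all other rewards vanish. The learner then faces `A` arms for `T = KH` rounds: the
arm `j` is good, with a Bernoulli reward of mean `(1 + δ) / 2`, and every other arm has mean `1 /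
2`. The regret is `δ / 2` times the expected number of rounds not spent on `j`
(`expectedRegret_bandit_armMean`).

Compare with the environment in which all arms have mean `1 / 2`. The law of the record with good
arm `j` has an explicit density with respect to the law in this environment, because policies,
actions and states contribute no factor to the likelihood ratio (`lintegral_bandit_law_change`,
`law_bandit_armMean_eq_withDensity`). The relative entropy of the two laws is at most `δ²` times the
expected number of plays of `j` in the fair environment (`integral_log_historyRatio`,
`neg_log_add_log_div_two_le`). A Pinsker-type inequality with a free parameter
(`integral_withDensity_le_add_entropy`) then bounds the expected number of plays of `j` when `j` is
good by its fair counterpart plus a small multiple of `T`.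

The fair counterparts sum to `T` over the arms. With `δ` of order `√(A / T)`, averaging over `j`
therefore yields an arm that is played at most `3T / 4` times on average even when it is good, so
the regret is of order `δT`, that is, `√(AT)` (`exists_le_expectedRegret`). -/

/-! ### Bandit environments -/

/-- The Bernoulli distribution on `{0, 1} ⊆ ℝ` with mean `p`. -/
def bernoulliReal (p : unitInterval) : ProbabilityMeasure ℝ :=
  ⟨ENNReal.ofReal p • Measure.dirac 1 + ENNReal.ofReal (1 - p) • Measure.dirac 0, ⟨by
    simp only [Measure.add_apply, Measure.smul_apply, measure_univ, smul_eq_mul, mul_one]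
    rw [← ENNReal.ofReal_add p.2.1 (by linarith [p.2.2])]
    simp⟩⟩

/-- The part of a value of the `i`-th reward scope variable which concerns the action. -/
def restrictAction (i : Fin F.l) (z : F.Scope (F.rewardScope i)) : F.Scope (F.actionPart i) :=
  fun k => z ⟨k, (Finset.mem_filter.1 k.2).1⟩

/-- The reward laws of a bandit: the `i`-th reward is Bernoulli with a mean that depends on the
action part of its scope, and the other rewards vanish. -/
def banditReward (i : Fin F.l) (p : F.Scope (F.actionPart i) → unitInterval) (i' : Fin F.l)
    (z : F.Scope (F.rewardScope i')) : ProbabilityMeasure ℝ :=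
  bernoulliReal (if h : i' = i then p (restrictAction i (h ▸ z)) else 0)

/-- The joint law of the rewards of a bandit is a mixture of two point masses. -/
theorem pi_banditReward (i : Fin F.l) (p : F.Scope (F.actionPart i) → unitInterval)
    (x : F.State × F.Action) :
    (Measure.pi fun i' => (banditReward i p i' (proj (F.rewardScope i') x) : Measure ℝ)) =
      ENNReal.ofReal (p (proj (F.actionPart i) x)) • Measure.dirac (Pi.single i 1) +
        ENNReal.ofReal (1 - p (proj (F.actionPart i) x)) • Measure.dirac 0 := by
  classical
  refine Measure.pi_eq fun t ht => ?_
  have hi : (banditReward i p i (proj (F.rewardScope i) x) : Measure ℝ) =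
      ENNReal.ofReal (p (proj (F.actionPart i) x)) • Measure.dirac 1 +
        ENNReal.ofReal (1 - p (proj (F.actionPart i) x)) • Measure.dirac 0 := by
    rw [banditReward, dif_pos rfl]
    rfl
  have hne : ∀ i' ∈ Finset.univ.erase i,
      (banditReward i p i' (proj (F.rewardScope i') x) : Measure ℝ) (t i') =
        (t i').indicator 1 (0 : ℝ) := by
    intro i' h
    rw [banditReward, dif_neg (Finset.ne_of_mem_erase h)]
    simp [bernoulliReal, Measure.dirac_apply' _ (ht i')]
  have hT : MeasurableSet (Set.univ.pi t) := MeasurableSet.univ_pi ht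
  rw [← Finset.mul_prod_erase _ _ (Finset.mem_univ i), Finset.prod_congr rfl hne, hi]
  -- One computation serves both atoms, since the zero vector is `Pi.single i 0`.
  have key : ∀ v : ℝ, (Set.univ.pi t).indicator (1 : (Fin F.l → ℝ) → ℝ≥0∞) (Pi.single i v) =
      (t i).indicator 1 v * ∏ i' ∈ Finset.univ.erase i, (t i').indicator 1 (0 : ℝ) := by
    intro v
    have h1 : (Set.univ.pi t).indicator (1 : (Fin F.l → ℝ) → ℝ≥0∞) (Pi.single i v) =
        ∏ i', (t i').indicator 1 ((Pi.single i v : Fin F.l → ℝ) i') := by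
      by_cases hm : (Pi.single i v : Fin F.l → ℝ) ∈ Set.univ.pi t
      · rw [Set.indicator_of_mem hm, Finset.prod_eq_one]
        · rfl
        · intro i' _
          rw [Set.indicator_of_mem (hm i' trivial)]
          rfl
      · rw [Set.indicator_of_notMem hm]
        simp only [Set.mem_pi, Set.mem_univ, true_imp_iff, not_forall] at hm
        obtain ⟨i', hi'⟩ := hm
        exact (Finset.prod_eq_zero (Finset.mem_univ i') (Set.indicator_of_notMem hi' _)).symm
    rw [h1, ← Finset.mul_prod_erase _ _ (Finset.mem_univ i), Pi.single_eq_same]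
    congr 1
    refine Finset.prod_congr rfl fun i' h => ?_
    rw [Pi.single_eq_of_ne (Finset.ne_of_mem_erase h)]
  have h0 := key 0
  rw [Pi.single_zero] at h0
  simp only [Measure.add_apply, Measure.smul_apply, smul_eq_mul, Measure.dirac_apply' _ hT,
    Measure.dirac_apply' _ (ht i), key 1, h0]
  ring

/-- The point mass at `a`. -/
def pointMass {α : Type*} [Fintype α] (a : α) : stdSimplex ℝ α := by
  classical
  exact ⟨fun b => if b = a then 1 else 0, fun b => by positivity, by simp⟩

/-- The bandit with mean rewards `p` (a function of the action part of the `i`-th reward scope) as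
an FMDP whose next state is always `s₀`. -/
def bandit (i : Fin F.l) (s₀ : F.State) (p : F.Scope (F.actionPart i) → unitInterval) :
    FMDP F where
  trans k _ := pointMass (s₀ k)
  reward := banditReward i p
  reward_mem x := by
    classical
    have h1 : MeasurableSet {r : Fin F.l → ℝ | (∀ i, 0 ≤ r i) ∧ ∑ i, r i ≤ 1} := by
      measurability
    rw [pi_banditReward, ae_add_measure_iff]
    constructor
    · refine Measure.ae_smul_measure ((ae_dirac_iff h1).2 ⟨fun i' => ?_, ?_⟩) _
      · by_cases h : i' = i
        · subst h; simp
        · simp [h]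
      · simp
    · exact Measure.ae_smul_measure ((ae_dirac_iff h1).2 (by simp)) _

/-! ### Integrals against the kernels of a bandit. -/

theorem lintegral_simplexKernel {α : Type*} [Fintype α] [MeasurableSpace α] (w : stdSimplex ℝ α)
    {f : α → ℝ≥0∞} (hf : Measurable f) :
    ∫⁻ a, f a ∂(simplexKernel α w) = ∑ a, ENNReal.ofReal (w.1 a) * f a := by
  change ∫⁻ a, f a ∂(∑ a, ENNReal.ofReal (w.1 a) • Measure.dirac a : Measure α) = _
  simp [lintegral_finsetSum_measure, lintegral_smul_measure, lintegral_dirac' _ hf]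

theorem bandit_transition (i : Fin F.l) (s₀ : F.State)
    (p : F.Scope (F.actionPart i) → unitInterval) (x : F.State × F.Action) :
    (bandit i s₀ p).transition x = pointMass s₀ := by
  classical
  refine Subtype.ext (funext fun s => ?_)
  simp only [FMDP.transition, bandit, pointMass]
  split_ifs with h
  · subst h; simp
  · obtain ⟨k, hk⟩ : ∃ k, s k ≠ s₀ k := by
      by_contra hc
      push Not at hc
      exact h (funext hc)
    exact Finset.prod_eq_zero (Finset.mem_univ k) (if_neg hk)

theorem lintegral_bandit_transitionKernel (i : Fin F.l) (s₀ : F.State)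
    (p : F.Scope (F.actionPart i) → unitInterval) (x : F.State × F.Action) (f : F.State → ℝ≥0∞) :
    ∫⁻ s, f s ∂((bandit i s₀ p).transitionKernel x) = f s₀ := by
  classical
  rw [FMDP.transitionKernel, Kernel.comap_apply, bandit_transition,
    lintegral_simplexKernel _ .of_discrete, Finset.sum_eq_single s₀]
  · simp [pointMass]
  · intro s _ h
    simp [pointMass, h]
  · simp

theorem lintegral_bandit_rewardKernel (i : Fin F.l) (s₀ : F.State)
    (p : F.Scope (F.actionPart i) → unitInterval) (x : F.State × F.Action)
    {f : (Fin F.l → ℝ) → ℝ≥0∞} (hf : Measurable f) :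
    ∫⁻ r, f r ∂((bandit i s₀ p).rewardKernel x) =
      ENNReal.ofReal (p (proj (F.actionPart i) x)) * f (Pi.single i 1) +
        ENNReal.ofReal (1 - p (proj (F.actionPart i) x)) * f 0 := by
  change ∫⁻ r, f r ∂(Measure.pi fun i' =>
    (banditReward i p i' (proj (F.rewardScope i') x) : Measure ℝ)) = _
  rw [pi_banditReward, lintegral_add_measure, lintegral_smul_measure, lintegral_smul_measure,
    lintegral_dirac' _ hf, lintegral_dirac' _ hf, smul_eq_mul, smul_eq_mul]

theorem lintegral_bandit_stepKernel (i : Fin F.l) (s₀ : F.State)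
    (p : F.Scope (F.actionPart i) → unitInterval) {H : ℕ} (π : Policy F (H + 1)) (s : F.State)
    {f : Step F → ℝ≥0∞} (hf : Measurable f) :
    ∫⁻ e, f e ∂((bandit i s₀ p).stepKernel H (π, s)) =
      ∑ a, ENNReal.ofReal ((π 0 s).1 a) *
        (ENNReal.ofReal (p (proj (F.actionPart i) (s, a))) * f ((s, a), (Pi.single i 1, s₀)) +
          ENNReal.ofReal (1 - p (proj (F.actionPart i) (s, a))) * f ((s, a), (0, s₀))) := by
  rw [FMDP.stepKernel, Kernel.lintegral_compProd _ _ _ hf]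
  have h1 : ∀ x : F.State × F.Action,
      ∫⁻ c, f (x, c) ∂(((bandit i s₀ p).rewardKernel ×ₖ (bandit i s₀ p).transitionKernel) x) =
      ENNReal.ofReal (p (proj (F.actionPart i) x)) * f (x, (Pi.single i 1, s₀)) +
          ENNReal.ofReal (1 - p (proj (F.actionPart i) x)) * f (x, (0, s₀)) := by
    intro x
    rw [Kernel.lintegral_prod _ _ _ (by fun_prop)]
    simp only [lintegral_bandit_transitionKernel]
    exact lintegral_bandit_rewardKernel i s₀ p x (by fun_prop)
  simp only [Kernel.comap_apply, h1]
  rw [actionKernel, Kernel.lintegral_prod _ _ _ .of_discrete,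
    Kernel.lintegral_deterministic' _ .of_discrete, Kernel.comap_apply,
    lintegral_simplexKernel _ .of_discrete]

/-- The first step of an episode is drawn from finitely many possibilities. -/
theorem lintegral_bandit_episodeKernel_succ (i : Fin F.l) (s₀ : F.State)
    (p : F.Scope (F.actionPart i) → unitInterval) {H : ℕ} (π : Policy F (H + 1)) (s : F.State)
    {f : Episode F (H + 1) → ℝ≥0∞} (hf : Measurable f) :
    ∫⁻ e, f e ∂((bandit i s₀ p).episodeKernel (H + 1) (π, s)) =
      ∑ a, ENNReal.ofReal ((π 0 s).1 a) *
        (ENNReal.ofReal (p (proj (F.actionPart i) (s, a))) *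
            ∫⁻ e, f (Fin.cons ((s, a), (Pi.single i 1, s₀)) e)
              ∂((bandit i s₀ p).episodeKernel H (fun h => π h.succ, s₀)) +
          ENNReal.ofReal (1 - p (proj (F.actionPart i) (s, a))) *
            ∫⁻ e, f (Fin.cons ((s, a), (0, s₀)) e)
              ∂((bandit i s₀ p).episodeKernel H (fun h => π h.succ, s₀))) := by
  have hc : Measurable fun e : Step F × Episode F H => f (Fin.cons e.1 e.2) :=
    hf.comp (measurable_cons H)
  rw [FMDP.episodeKernel, Kernel.lintegral_map _ (measurable_cons H) _ hf,
    Kernel.lintegral_compProd _ _ _ hc, lintegral_bandit_stepKernel]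
  · rfl
  · exact hc.lintegral_kernel_prod_right''

/-! ### Change of measure -/

theorem measurable_cons_left {H : ℕ} (σ : Step F) :
    Measurable fun e : Episode F H => (Fin.cons σ e : Episode F (H + 1)) :=
  (measurable_cons H).comp measurable_prodMk_left

theorem measurable_prod_episode {H : ℕ} {ρ : Step F → ℝ≥0∞} (hρ : Measurable ρ) :
    Measurable fun e : Episode F H => ∏ h, ρ (e h) :=
  Finset.measurable_prod _ fun h _ => hρ.comp (measurable_pi_apply h)

/-- If `ρ` is the likelihood ratio of one step in two bandits, then the product of its values is
the likelihood ratio of an episode. -/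
theorem lintegral_bandit_episodeKernel_change (i : Fin F.l) (s₀ : F.State)
    {p q : F.Scope (F.actionPart i) → unitInterval} {ρ : Step F → ℝ≥0∞} (hρ : Measurable ρ)
    (h₁ : ∀ s a, ENNReal.ofReal (p (proj (F.actionPart i) (s, a))) =
      ρ ((s, a), (Pi.single i 1, s₀)) * ENNReal.ofReal (q (proj (F.actionPart i) (s, a))))
    (h₀ : ∀ s a, ENNReal.ofReal (1 - p (proj (F.actionPart i) (s, a))) =
      ρ ((s, a), (0, s₀)) * ENNReal.ofReal (1 - q (proj (F.actionPart i) (s, a))))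
    {H : ℕ} (π : Policy F H) (s : F.State) {f : Episode F H → ℝ≥0∞} (hf : Measurable f) :
    ∫⁻ e, f e ∂((bandit i s₀ p).episodeKernel H (π, s)) =
      ∫⁻ e, (∏ h, ρ (e h)) * f e ∂((bandit i s₀ q).episodeKernel H (π, s)) := by
  -- The initial state is arbitrary, but from the second step on the state is `s₀`, so the induction
  -- hypothesis is needed at `s₀`.
  induction H generalizing s with
  | zero => simp [FMDP.episodeKernel]
  | succ H ih =>
    have hm : Measurable fun e : Episode F (H + 1) => (∏ h, ρ (e h)) * f e :=
      (measurable_prod_episode hρ).mul hf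
    rw [lintegral_bandit_episodeKernel_succ _ _ _ _ _ hf,
      lintegral_bandit_episodeKernel_succ _ _ _ _ _ hm]
    have key : ∀ σ : Step F,
        ∫⁻ e, (∏ h, ρ ((Fin.cons σ e : Episode F (H + 1)) h)) * f (Fin.cons σ e)
            ∂((bandit i s₀ q).episodeKernel H (fun h => π h.succ, s₀)) =
          ρ σ * ∫⁻ e, f (Fin.cons σ e)
            ∂((bandit i s₀ p).episodeKernel H (fun h => π h.succ, s₀)) := by
      intro σ
      have hfσ : Measurable fun e : Episode F H => f (Fin.cons σ e) :=
        hf.comp (measurable_cons_left σ)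
      have hmσ : Measurable fun e : Episode F H => (∏ h, ρ (e h)) * f (Fin.cons σ e) :=
        (measurable_prod_episode hρ).mul hfσ
      rw [ih (fun h => π h.succ) s₀ hfσ, ← lintegral_const_mul _ hmσ]
      refine lintegral_congr fun e => ?_
      simp [Fin.prod_univ_succ, mul_assoc]
    simp only [key, h₁, h₀]
    refine Finset.sum_congr rfl fun a _ => ?_
    ring

/-- The likelihood ratio of the record of `K` episodes. -/
theorem lintegral_bandit_law_change (i : Fin F.l) (s₀ : F.State)
    {p q : F.Scope (F.actionPart i) → unitInterval} {ρ : Step F → ℝ≥0∞} (hρ : Measurable ρ)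
    (h₁ : ∀ s a, ENNReal.ofReal (p (proj (F.actionPart i) (s, a))) =
      ρ ((s, a), (Pi.single i 1, s₀)) * ENNReal.ofReal (q (proj (F.actionPart i) (s, a))))
    (h₀ : ∀ s a, ENNReal.ofReal (1 - p (proj (F.actionPart i) (s, a))) =
      ρ ((s, a), (0, s₀)) * ENNReal.ofReal (1 - q (proj (F.actionPart i) (s, a))))
    {H : ℕ} (alg : Algorithm F H) (s : ℕ → F.State) (K : ℕ) {f : History F H K → ℝ≥0∞}
    (hf : Measurable f) :
    ∫⁻ η, f η ∂(alg.law (bandit i s₀ p) s K) =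
      ∫⁻ η, (∏ k, ∏ h, ρ ((η k).2 h)) * f η ∂(alg.law (bandit i s₀ q) s K) := by
  have hep : Measurable fun e : Episode F H => ∏ h, ρ (e h) := measurable_prod_episode hρ
  have hhist : ∀ K, Measurable fun η : History F H K => ∏ k, ∏ h, ρ ((η k).2 h) := fun K =>
    Finset.measurable_prod _ fun k _ => hep.comp (measurable_snd.comp (measurable_pi_apply k))
  -- Splits off the last episode. The kernel `alg.select` does not depend on the bandit, so only the
  -- episode contributes to the likelihood ratio.
  have succ : ∀ (r : F.Scope (F.actionPart i) → unitInterval) (K : ℕ)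
      {f : History F H (K + 1) → ℝ≥0∞}, Measurable f →
      ∫⁻ η, f η ∂(alg.law (bandit i s₀ r) s (K + 1)) =
        ∫⁻ η, ∫⁻ π, ∫⁻ e, f (Fin.snoc η (π, e)) ∂((bandit i s₀ r).episodeKernel H (π, s K))
          ∂(alg.select K (η, s K)) ∂(alg.law (bandit i s₀ r) s K) := by
    intro r K f hf
    have hf' : Measurable fun e : History F H K × (Policy F H × Episode F H) =>
        f (Fin.snoc e.1 e.2) := hf.comp (measurable_snoc _ K)
    rw [Algorithm.law, lintegral_map hf (measurable_snoc _ K), Measure.lintegral_compProd hf']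
    refine lintegral_congr fun η => ?_
    exact Kernel.lintegral_compProd _ _ _ (hf'.comp measurable_prodMk_left)
  induction K with
  | zero => simp [Algorithm.law]
  | succ K ih =>
    have hm : Measurable fun η : History F H (K + 1) => (∏ k, ∏ h, ρ ((η k).2 h)) * f η :=
      (hhist _).mul hf
    rw [succ p K hf, succ q K hm, ih]
    · refine lintegral_congr fun η => ?_
      rw [← lintegral_const_mul]
      · refine lintegral_congr fun π => ?_
        have hf' : Measurable fun e : Episode F H =>
          f (Fin.snoc (α := fun _ => Policy F H × Episode F H) η (π, e)) :=
          hf.comp ((measurable_snoc _ K).comp (measurable_prodMk_left.comp measurable_prodMk_left))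
        have hm' : Measurable fun e : Episode F H => (∏ h, ρ (e h)) *
          f (Fin.snoc (α := fun _ => Policy F H × Episode F H) η (π, e)) := hep.mul hf'
        rw [lintegral_bandit_episodeKernel_change i s₀ hρ h₁ h₀ π (s K) hf',
          ← lintegral_const_mul _ hm']
        refine lintegral_congr fun e => ?_
        rw [Fin.prod_univ_castSucc]
        simp [mul_assoc]
      · exact Measurable.lintegral_kernel_prod_right'
          (κ := ((bandit i s₀ p).episodeKernel H).comap (fun π => (π, s K)) (by fun_prop))
          (hf.comp ((measurable_snoc _ K).comp measurable_prodMk_left))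
    -- The induction hypothesis asks that the inner double integral be measurable in `η`; this holds
    -- because it is an integral against the single kernel `nextKernel`.
    · have heq : (fun η => ∫⁻ q, f (Fin.snoc η q) ∂(alg.nextKernel (bandit i s₀ p) (s K) K η)) =
          fun η => ∫⁻ π, ∫⁻ e, f (Fin.snoc η (π, e)) ∂((bandit i s₀ p).episodeKernel H (π, s K))
            ∂(alg.select K (η, s K)) := funext fun η =>
        Kernel.lintegral_compProd _ _ _
          ((hf.comp (measurable_snoc _ K)).comp measurable_prodMk_left)
      rw [← heq]
      exact Measurable.lintegral_kernel_prod_right' (hf.comp (measurable_snoc _ K))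

/-! ### Expectations of additive functionals -/

/-- The expectation of a sum over the steps of an episode. -/
theorem integral_bandit_episodeKernel_sum (i : Fin F.l) (s₀ : F.State)
    (p : F.Scope (F.actionPart i) → unitInterval) {ψ : Step F → ℝ} (hψ : Measurable ψ)
    {c : F.Action → ℝ}
    (hc : ∀ a, p (proj (F.actionPart i) (s₀, a)) * ψ ((s₀, a), (Pi.single i 1, s₀)) +
      (1 - p (proj (F.actionPart i) (s₀, a))) * ψ ((s₀, a), (0, s₀)) = c a)
    {H : ℕ} (π : Policy F H) :
    Integrable (fun e : Episode F H => ∑ h, ψ (e h)) ((bandit i s₀ p).episodeKernel H (π, s₀)) ∧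
      ∫ e, ∑ h, ψ (e h) ∂((bandit i s₀ p).episodeKernel H (π, s₀)) =
        ∑ h, ∑ a, (π h s₀).1 a * c a := by
  induction H with
  | zero => simp
  | succ H ih =>
    set μ := (bandit i s₀ p).episodeKernel H (fun h => π h.succ, s₀) with hμ
    obtain ⟨hI, hE⟩ := ih fun h => π h.succ
    rw [← hμ] at hI hE
    -- The recursion for `lintegral` becomes an identity of measures, which makes it available for
    -- real-valued integrands.
    have hdecomp : (bandit i s₀ p).episodeKernel (H + 1) (π, s₀) =
        ∑ a, ENNReal.ofReal ((π 0 s₀).1 a) •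
          (ENNReal.ofReal (p (proj (F.actionPart i) (s₀, a))) •
              μ.map (Fin.cons ((s₀, a), (Pi.single i 1, s₀))) +
            ENNReal.ofReal (1 - p (proj (F.actionPart i) (s₀, a))) •
              μ.map (Fin.cons ((s₀, a), (0, s₀)))) := by
      refine Measure.ext_of_lintegral _ fun f hf => ?_
      rw [lintegral_bandit_episodeKernel_succ _ _ _ _ _ hf, lintegral_finsetSum_measure]
      refine Finset.sum_congr rfl fun a _ => ?_
      rw [lintegral_smul_measure, lintegral_add_measure, lintegral_smul_measure,
        lintegral_smul_measure, lintegral_map hf (measurable_cons_left _),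
        lintegral_map hf (measurable_cons_left _)]
      rfl
    have hmeas : Measurable fun e : Episode F (H + 1) => ∑ h, ψ (e h) := by fun_prop
    have hcons : ∀ σ : Step F,
        Integrable (fun e : Episode F (H + 1) => ∑ h, ψ (e h)) (μ.map (Fin.cons σ)) ∧
          ∫ e, ∑ h, ψ (e h) ∂(μ.map (Fin.cons σ)) =
            ψ σ + ∑ h : Fin H, ∑ a, (π h.succ s₀).1 a * c a := by
      intro σ
      have hm : AEMeasurable (fun e : Episode F H => (Fin.cons σ e : Episode F (H + 1))) μ :=
        (measurable_cons_left σ).aemeasurable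
      have hcomp : ∀ e : Episode F H,
          ∑ h, ψ ((Fin.cons σ e : Episode F (H + 1)) h) = ψ σ + ∑ h, ψ (e h) := by
        intro e
        simp [Fin.sum_univ_succ]
      constructor
      · rw [integrable_map_measure hmeas.aestronglyMeasurable hm]
        exact ((integrable_const (ψ σ)).add hI).congr (.of_forall fun e => (hcomp e).symm)
      · rw [integral_map hm hmeas.aestronglyMeasurable]
        simp only [hcomp]
        rw [integral_add (integrable_const _) hI, hE]
        simp
    have hsmul : ∀ (t : ℝ) (σ : Step F), Integrable (fun e : Episode F (H + 1) => ∑ h, ψ (e h))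
        (ENNReal.ofReal t • μ.map (Fin.cons σ)) := fun t σ =>
      (hcons σ).1.smul_measure ENNReal.ofReal_ne_top
    have hsum : ∀ a ∈ Finset.univ, Integrable (fun e : Episode F (H + 1) => ∑ h, ψ (e h))
        (ENNReal.ofReal ((π 0 s₀).1 a) •
          (ENNReal.ofReal (p (proj (F.actionPart i) (s₀, a))) •
              μ.map (Fin.cons ((s₀, a), (Pi.single i 1, s₀))) +
            ENNReal.ofReal (1 - p (proj (F.actionPart i) (s₀, a))) •
              μ.map (Fin.cons ((s₀, a), (0, s₀))))) := fun a _ =>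
      ((hsmul _ _).add_measure (hsmul _ _)).smul_measure ENNReal.ofReal_ne_top
    rw [hdecomp]
    refine ⟨integrable_finsetSum_measure.2 hsum, ?_⟩
    rw [integral_finsetSum_measure hsum, Fin.sum_univ_succ]
    have hone : ∑ a, (π 0 s₀).1 a = 1 := (π 0 s₀).2.2
    have hterm : ∀ a, ∫ e, ∑ h, ψ (e h) ∂(ENNReal.ofReal ((π 0 s₀).1 a) •
          (ENNReal.ofReal (p (proj (F.actionPart i) (s₀, a))) •
              μ.map (Fin.cons ((s₀, a), (Pi.single i 1, s₀))) +
            ENNReal.ofReal (1 - p (proj (F.actionPart i) (s₀, a))) •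
              μ.map (Fin.cons ((s₀, a), (0, s₀))))) =
        (π 0 s₀).1 a * c a +
          (π 0 s₀).1 a * ∑ h : Fin H, ∑ a, (π h.succ s₀).1 a * c a := by
      intro a
      rw [integral_smul_measure, integral_add_measure (hsmul _ _) (hsmul _ _),
        integral_smul_measure, integral_smul_measure, (hcons _).2, (hcons _).2,
        ENNReal.toReal_ofReal ((π 0 s₀).2.1 a), ENNReal.toReal_ofReal (p _).2.1,
        ENNReal.toReal_ofReal (by linarith [(p (proj (F.actionPart i) (s₀, a))).2.2]), ← hc a]
      simp only [smul_eq_mul]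
      ring
    rw [Finset.sum_congr rfl fun a _ => hterm a, Finset.sum_add_distrib, ← Finset.sum_mul, hone,
      one_mul]

/-- A sum over episodes of terms with conditional mean zero has mean zero. -/
theorem integral_law_sum_eq_zero {H : ℕ} (alg : Algorithm F H) (M : FMDP F) (s₀ : F.State)
    {φ : Policy F H × Episode F H → ℝ} (hφ : Measurable φ) {B : ℝ} (hB : ∀ q, |φ q| ≤ B)
    (hz : ∀ π, ∫ e, φ (π, e) ∂(M.episodeKernel H (π, s₀)) = 0) (K : ℕ) :
    ∫ η, ∑ k, φ (η k) ∂(alg.law M (fun _ => s₀) K) = 0 := by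
  induction K with
  | zero => simp
  | succ K ih =>
    have hmeas : ∀ K, Measurable fun η : History F H K => ∑ k, φ (η k) := by
      intro K; fun_prop
    have hint : ∀ (K : ℕ) (μ : Measure (History F H K)) [IsProbabilityMeasure μ],
        Integrable (fun η => ∑ k, φ (η k)) μ := by
      intro K μ _
      refine integrable_finsetSum _ fun k _ => Integrable.of_bound (C := B)
        (hφ.comp (measurable_pi_apply k)).aestronglyMeasurable (.of_forall fun η => hB _)
    have hmap : ∀ e : History F H K × (Policy F H × Episode F H),
        ∑ k, φ ((Fin.snoc e.1 e.2 : History F H (K + 1)) k) = ∑ k, φ (e.1 k) + φ e.2 := by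
      intro e
      simp [Fin.sum_univ_castSucc]
    rw [Algorithm.law, integral_map (measurable_snoc _ K).aemeasurable
      (hmeas _).aestronglyMeasurable]
    simp only [hmap]
    have hi₁ : Integrable (fun e : History F H K × (Policy F H × Episode F H) => ∑ k, φ (e.1 k))
        (alg.law M (fun _ => s₀) K ⊗ₘ alg.nextKernel M s₀ K) :=
      integrable_finsetSum _ fun k _ => Integrable.of_bound (C := B)
        (hφ.comp ((measurable_pi_apply k).comp measurable_fst)).aestronglyMeasurable
        (.of_forall fun η => hB _)
    have hi₂ : Integrable (fun e : History F H K × (Policy F H × Episode F H) => φ e.2)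
        (alg.law M (fun _ => s₀) K ⊗ₘ alg.nextKernel M s₀ K) :=
      Integrable.of_bound (C := B) (hφ.comp measurable_snd).aestronglyMeasurable
        (.of_forall fun η => hB _)
    -- `hz` holds for every policy, so it does not matter how the algorithm selected this one.
    have hnext : ∀ η, ∫ q, φ q ∂(alg.nextKernel M s₀ K η) = 0 := by
      intro η
      rw [Algorithm.nextKernel, ProbabilityTheory.integral_compProd]
      · simp [hz]
      · exact Integrable.of_bound (C := B) hφ.aestronglyMeasurable (.of_forall fun η => hB _)
    rw [integral_add hi₁ hi₂, Measure.integral_compProd hi₁, Measure.integral_compProd hi₂]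
    simp [hnext, ih]

/-! ### An information inequality -/

/-- With `s = √L`, the bound `log s ≤ s - 1` gives `(s - 1)² ≤ L - 1 - log L`, and the weighted
arithmetic-geometric mean inequality applied to `L - 1 = (s - 1)(s + 1)` does the rest. Integrated
against a probability measure with density `L`, the term `L - 1 - log L` becomes the relative
entropy. -/
theorem sub_one_le_relative_entropy_term {L t : ℝ} (hL : 0 < L) (ht : 0 < t) :
    L - 1 ≤ (L - 1 - Real.log L) / (2 * t) + t * (1 + L) := by
  obtain ⟨s, hs, rfl⟩ : ∃ s : ℝ, 0 < s ∧ s ^ 2 = L := ⟨√L, Real.sqrt_pos.2 hL, Real.sq_sqrt hL.le⟩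
  have h1 : Real.log (s ^ 2) ≤ 2 * (s - 1) := by
    rw [Real.log_pow]
    push_cast
    linarith [Real.log_le_sub_one_of_pos hs]
  have h2 : (s - 1) ^ 2 / (2 * t) ≤ (s ^ 2 - 1 - Real.log (s ^ 2)) / (2 * t) := by
    gcongr
    nlinarith
  have h3 : s ^ 2 - 1 ≤ (s - 1) ^ 2 / (2 * t) + t * (1 + s ^ 2) := by
    rw [← sub_le_iff_le_add, le_div_iff₀ (by positivity)]
    nlinarith [sq_nonneg ((s - 1) - t * (s + 1)), mul_nonneg (sq_nonneg t) (sq_nonneg (s - 1))]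
  linarith

/-- A bounded quantity has similar means under two probability measures whose relative entropy is
small. -/
theorem integral_withDensity_le_add_entropy {Ω : Type*} [MeasurableSpace Ω] {μ : Measure Ω}
    [IsProbabilityMeasure μ] {L N : Ω → ℝ} (hL : Measurable L) (hpos : ∀ ω, 0 < L ω)
    [IsProbabilityMeasure (μ.withDensity fun ω => ENNReal.ofReal (L ω))]
    (hlog : Integrable (fun ω => Real.log (L ω)) μ) (hN : Measurable N) {T : ℝ}
    (hN0 : ∀ ω, 0 ≤ N ω) (hNT : ∀ ω, N ω ≤ T) {t : ℝ} (ht : 0 < t) :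
    ∫ ω, N ω ∂(μ.withDensity fun ω => ENNReal.ofReal (L ω)) ≤
      ∫ ω, N ω ∂μ + T * ((∫ ω, -Real.log (L ω) ∂μ) / (2 * t) + 2 * t) := by
  have hone : ∫⁻ ω, ENNReal.ofReal (L ω) ∂μ = 1 := by
    have := measure_univ (μ := μ.withDensity fun ω => ENNReal.ofReal (L ω))
    rwa [withDensity_apply _ MeasurableSet.univ, setLIntegral_univ] at this
  have hLI : Integrable L μ := by
    refine ⟨hL.aestronglyMeasurable, ?_⟩
    rw [hasFiniteIntegral_iff_ofReal (.of_forall fun ω => (hpos ω).le), hone]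
    exact ENNReal.one_lt_top
  have hL1 : ∫ ω, L ω ∂μ = 1 := by
    rw [integral_eq_lintegral_of_nonneg_ae (.of_forall fun ω => (hpos ω).le)
      hL.aestronglyMeasurable, hone, ENNReal.toReal_one]
  have hbd : ∀ ω, ‖N ω‖ ≤ T := fun ω => by
    rw [Real.norm_of_nonneg (hN0 ω)]
    exact hNT ω
  have hNI : Integrable N μ := Integrable.of_bound (C := T) hN.aestronglyMeasurable (.of_forall hbd)
  have hLN : Integrable (fun ω => N ω * L ω) μ :=
    hLI.bdd_mul hN.aestronglyMeasurable (.of_forall hbd)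
  rw [integral_withDensity_eq_integral_toReal_smul hL.ennreal_ofReal
    (.of_forall fun ω => ENNReal.ofReal_lt_top)]
  have hI₁ : Integrable (fun ω => L ω - 1) μ := hLI.sub (integrable_const 1)
  have hI₂ : Integrable (fun ω => L ω - 1 - Real.log (L ω)) μ := hI₁.sub hlog
  have hI₃ : Integrable (fun ω => 1 + L ω) μ := (integrable_const 1).add hLI
  have hR : Integrable (fun ω => (L ω - 1 - Real.log (L ω)) / (2 * t) + t * (1 + L ω)) μ :=
    (hI₂.div_const _).add (hI₃.const_mul t)
  have hRval : ∫ ω, (L ω - 1 - Real.log (L ω)) / (2 * t) + t * (1 + L ω) ∂μ =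
      (∫ ω, -Real.log (L ω) ∂μ) / (2 * t) + 2 * t := by
    rw [integral_add (hI₂.div_const _) (hI₃.const_mul t), integral_div, integral_const_mul,
      integral_sub hI₁ hlog, integral_sub hLI (integrable_const 1),
      integral_add (integrable_const 1) hLI, hL1, integral_neg]
    simp
    ring
  rw [← hRval, ← integral_const_mul, ← integral_add hNI (hR.const_mul T)]
  refine integral_mono (hLN.congr (.of_forall fun ω => ?_)) (hNI.add (hR.const_mul T)) fun ω => ?_
  · simp [ENNReal.toReal_ofReal (hpos ω).le, mul_comm]
  · have h1 := sub_one_le_relative_entropy_term (hpos ω) ht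
    -- The pointwise inequality is multiplied by `N ω`, which is then replaced by the bound `T`; the
    -- latter needs this nonnegativity.
    have h2 : 0 ≤ (L ω - 1 - Real.log (L ω)) / (2 * t) + t * (1 + L ω) := by
      have := Real.log_le_sub_one_of_pos (hpos ω)
      have := hpos ω
      have : 0 ≤ L ω - 1 - Real.log (L ω) := by linarith
      positivity
    simp only [ENNReal.toReal_ofReal (hpos ω).le, smul_eq_mul]
    nlinarith [mul_le_mul_of_nonneg_left h1 (hN0 ω), mul_le_mul_of_nonneg_right (hNT ω) h2]

/-! ### Bandits with one good arm -/

open scoped Classical in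
/-- Mean rewards which are larger by `δ / 2` at `j` than elsewhere. -/
def armMean {α : Type*} (j : α) (δ : unitInterval) (b : α) : unitInterval :=
  if b = j then ⟨(1 + δ) / 2, by linarith [δ.2.1], by linarith [δ.2.2]⟩ else
    ⟨1 / 2, by norm_num, by norm_num⟩

/-- Allows one fair environment to be the reference for all arms. -/
theorem armMean_zero {α : Type*} (j j' : α) : armMean j 0 = armMean j' 0 := by
  funext b
  simp only [armMean]
  split_ifs <;> simp

open scoped Classical in
/-- The indicator of the steps at which the arm `j` is played. -/
def armIndicator (i : Fin F.l) (j : F.Scope (F.actionPart i)) (x : F.State × F.Action) : ℝ :=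
  if proj (F.actionPart i) x = j then 1 else 0

theorem armIndicator_nonneg (i : Fin F.l) (j : F.Scope (F.actionPart i))
    (x : F.State × F.Action) : 0 ≤ armIndicator i j x := by
  unfold armIndicator; positivity

theorem armIndicator_le_one (i : Fin F.l) (j : F.Scope (F.actionPart i))
    (x : F.State × F.Action) : armIndicator i j x ≤ 1 := by
  unfold armIndicator; split_ifs <;> norm_num

theorem sum_armIndicator (i : Fin F.l) (x : F.State × F.Action)
    [Fintype (F.Scope (F.actionPart i))] :
    ∑ j, armIndicator i j x = 1 := by
  simp [armIndicator]

theorem coe_armMean_proj (i : Fin F.l) (j : F.Scope (F.actionPart i)) (δ : unitInterval)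
    (x : F.State × F.Action) :
    (armMean j δ (proj (F.actionPart i) x) : ℝ) = 1 / 2 + δ / 2 * armIndicator i j x := by
  simp only [armMean, armIndicator]
  split_ifs
  · simp; ring
  · simp

/-- The number of steps of an episode at which the arm `j` is played. -/
def armCount (i : Fin F.l) (j : F.Scope (F.actionPart i)) {H : ℕ} (e : Episode F H) : ℝ :=
  ∑ h, armIndicator i j (e h).1

/-- The expected number of steps at which a policy plays the arm `j` in `s₀`. -/
def armWeight (i : Fin F.l) (j : F.Scope (F.actionPart i)) (s₀ : F.State) {H : ℕ}
    (π : Policy F H) : ℝ :=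
  ∑ h, ∑ a, (π h s₀).1 a * armIndicator i j (s₀, a)

theorem measurable_armIndicator (i : Fin F.l) (j : F.Scope (F.actionPart i)) :
    Measurable fun σ : Step F => armIndicator i j σ.1 :=
  (Measurable.of_discrete (f := armIndicator i j)).comp measurable_fst

theorem measurable_armCount (i : Fin F.l) (j : F.Scope (F.actionPart i)) {H : ℕ} :
    Measurable (armCount i j : Episode F H → ℝ) :=
  Finset.measurable_sum _ fun h _ => (measurable_armIndicator i j).comp (measurable_pi_apply h)

theorem measurable_armWeight (i : Fin F.l) (j : F.Scope (F.actionPart i)) (s₀ : F.State) {H : ℕ} :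
    Measurable (armWeight i j s₀ : Policy F H → ℝ) :=
  Finset.measurable_sum _ fun h _ => Finset.measurable_sum _ fun a _ =>
    ((measurable_pi_apply a).comp (measurable_subtype_coe.comp
      ((measurable_pi_apply s₀).comp (measurable_pi_apply h)))).mul_const _

theorem armCount_nonneg (i : Fin F.l) (j : F.Scope (F.actionPart i)) {H : ℕ} (e : Episode F H) :
    0 ≤ armCount i j e :=
  Finset.sum_nonneg fun _ _ => armIndicator_nonneg i j _

theorem armCount_le (i : Fin F.l) (j : F.Scope (F.actionPart i)) {H : ℕ} (e : Episode F H) :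
    armCount i j e ≤ H := by
  simpa [armCount] using Finset.sum_le_sum fun h (_ : h ∈ Finset.univ) => armIndicator_le_one i j (e h).1

theorem sum_policy {H : ℕ} (π : Policy F H) (s₀ : F.State) : ∑ h, ∑ a, (π h s₀).1 a = (H : ℝ) := by
  rw [Finset.sum_congr rfl fun h _ => (π h s₀).2.2]
  simp

theorem armWeight_nonneg (i : Fin F.l) (j : F.Scope (F.actionPart i)) (s₀ : F.State) {H : ℕ}
    (π : Policy F H) : 0 ≤ armWeight i j s₀ π :=
  Finset.sum_nonneg fun h _ => Finset.sum_nonneg fun a _ =>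
    mul_nonneg ((π h s₀).2.1 a) (armIndicator_nonneg i j _)

theorem armWeight_le (i : Fin F.l) (j : F.Scope (F.actionPart i)) (s₀ : F.State) {H : ℕ}
    (π : Policy F H) : armWeight i j s₀ π ≤ H := by
  rw [← sum_policy π s₀]
  exact Finset.sum_le_sum fun h _ => Finset.sum_le_sum fun a _ =>
    mul_le_of_le_one_right ((π h s₀).2.1 a) (armIndicator_le_one i j _)

/-! ### Values and regret in terms of numbers of plays. -/

theorem value_bandit_armMean (i : Fin F.l) (s₀ : F.State) (j : F.Scope (F.actionPart i))
    (δ : unitInterval) {H : ℕ} (π : Policy F H) :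
    (bandit i s₀ (armMean j δ)).value π s₀ = H / 2 + δ / 2 * armWeight i j s₀ π := by
  have h := (integral_bandit_episodeKernel_sum i s₀ (armMean j δ)
    (ψ := fun σ => ∑ i', σ.2.1 i') (by fun_prop)
    (c := fun a => 1 / 2 + δ / 2 * armIndicator i j (s₀, a)) (fun a => by
      rw [coe_armMean_proj]
      simp) π).2
  rw [FMDP.value, h, ← sum_policy π s₀, armWeight]
  simp only [mul_add, Finset.sum_add_distrib, Finset.mul_sum, Finset.sum_div]
  congr 1
  · exact Finset.sum_congr rfl fun _ _ => Finset.sum_congr rfl fun _ _ => by ring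
  · exact Finset.sum_congr rfl fun _ _ => Finset.sum_congr rfl fun _ _ => by ring

/-- Every arm is played by some action. -/
theorem exists_proj_actionPart_eq (i : Fin F.l) (j : F.Scope (F.actionPart i)) (s₀ : F.State) :
    ∃ a : F.Action, proj (F.actionPart i) (s₀, a) = j := by
  classical
  refine ⟨fun k => if h : Sum.inr k ∈ F.actionPart i then j ⟨Sum.inr k, h⟩ else
    Classical.arbitrary _, funext fun ⟨k, hk⟩ => ?_⟩
  rcases k with k | k
  · simp [actionPart] at hk
  · simp [proj, hk]

/-- The weight of the good arm is at most `H`, and always playing an action that projects to `j`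
attains this. -/
theorem optValue_bandit_armMean (i : Fin F.l) (s₀ : F.State) (j : F.Scope (F.actionPart i))
    (δ : unitInterval) (H : ℕ) :
    (bandit i s₀ (armMean j δ)).optValue H s₀ = H / 2 + δ / 2 * H := by
  obtain ⟨a, ha⟩ := exists_proj_actionPart_eq i j s₀
  let π : Policy F H := fun _ _ => pointMass a
  have hle : ∀ π : Policy F H,
      (bandit i s₀ (armMean j δ)).value π s₀ ≤ H / 2 + δ / 2 * H := fun π => by
    rw [value_bandit_armMean]
    have := δ.2.1
    gcongr
    exact armWeight_le i j s₀ π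
  have : Nonempty (Policy F H) := ⟨π⟩
  refine le_antisymm (ciSup_le hle) ((le_of_eq ?_).trans
    (le_ciSup ⟨_, Set.forall_mem_range.2 hle⟩ π))
  have hw : armWeight i j s₀ π = H := by
    have h1 : ∑ b, (pointMass a).1 b * armIndicator i j (s₀, b) = 1 := by
      rw [Finset.sum_eq_single a]
      · simp [pointMass, armIndicator, ha]
      · intro b _ hb
        simp [pointMass, hb]
      · simp
    simp [armWeight, π, h1]
  rw [value_bandit_armMean, hw]

/-- The total number of plays of the arm `j`. -/
def totalArmCount (i : Fin F.l) (j : F.Scope (F.actionPart i)) {H K : ℕ} (η : History F H K) : ℝ :=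
  ∑ k, armCount i j (η k).2

theorem measurable_totalArmCount (i : Fin F.l) (j : F.Scope (F.actionPart i)) {H K : ℕ} :
    Measurable (totalArmCount i j : History F H K → ℝ) :=
  Finset.measurable_sum _ fun k _ =>
    (measurable_armCount i j).comp (measurable_snd.comp (measurable_pi_apply k))

theorem totalArmCount_nonneg (i : Fin F.l) (j : F.Scope (F.actionPart i)) {H K : ℕ}
    (η : History F H K) : 0 ≤ totalArmCount i j η :=
  Finset.sum_nonneg fun _ _ => armCount_nonneg i j _

theorem totalArmCount_le (i : Fin F.l) (j : F.Scope (F.actionPart i)) {H K : ℕ}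
    (η : History F H K) : totalArmCount i j η ≤ (K * H : ℕ) := by
  simpa [totalArmCount] using Finset.sum_le_sum fun k (_ : k ∈ Finset.univ) => armCount_le i j (η k).2

theorem integrable_totalArmCount (i : Fin F.l) (j : F.Scope (F.actionPart i)) {H K : ℕ}
    (μ : Measure (History F H K)) [IsProbabilityMeasure μ] :
    Integrable (totalArmCount i j) μ :=
  Integrable.of_bound (C := (K * H : ℕ)) (measurable_totalArmCount i j).aestronglyMeasurable
    (.of_forall fun η => by
      rw [Real.norm_of_nonneg (totalArmCount_nonneg i j η)]
      exact totalArmCount_le i j η)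

/-- Each step plays exactly one arm. This budget is what forces some arm to be neglected. -/
theorem sum_integral_totalArmCount (i : Fin F.l) [Fintype (F.Scope (F.actionPart i))] {H K : ℕ}
    (μ : Measure (History F H K)) [IsProbabilityMeasure μ] :
    ∑ j, ∫ η, totalArmCount i j η ∂μ = (K * H : ℕ) := by
  rw [← integral_finsetSum _ fun j _ => integrable_totalArmCount i j μ]
  have : ∀ η : History F H K, ∑ j, totalArmCount i j η = (K * H : ℕ) := by
    intro η
    simp only [totalArmCount, armCount]
    rw [Finset.sum_comm]
    simp_rw [Finset.sum_comm (s := (Finset.univ : Finset (F.Scope (F.actionPart i)))),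
      sum_armIndicator]
    simp
  simp [this]

/-- The regret involves the weights that the chosen policies give to `j`. Actual plays minus weights
have conditional mean zero in each episode, so the weights can be exchanged for plays, the quantity
that also governs the relative entropy. -/
theorem expectedRegret_bandit_armMean (i : Fin F.l) (s₀ : F.State) (j : F.Scope (F.actionPart i))
    (δ : unitInterval) {H : ℕ} (alg : Algorithm F H) (K : ℕ) :
    alg.expectedRegret (bandit i s₀ (armMean j δ)) (fun _ => s₀) K =
      δ / 2 * ((K * H : ℕ) -
        ∫ η, totalArmCount i j η ∂(alg.law (bandit i s₀ (armMean j δ)) (fun _ => s₀) K)) := by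
  set M := bandit i s₀ (armMean j δ) with hM
  have hmeas : Measurable fun q : Policy F H × Episode F H =>
      armCount i j q.2 - armWeight i j s₀ q.1 :=
    ((measurable_armCount i j).comp measurable_snd).sub
      ((measurable_armWeight i j s₀).comp measurable_fst)
  have hB : ∀ q : Policy F H × Episode F H, |armCount i j q.2 - armWeight i j s₀ q.1| ≤ H := by
    intro q
    rw [abs_le]
    constructor <;> linarith [armCount_nonneg i j q.2, armCount_le i j q.2,
      armWeight_nonneg i j s₀ q.1, armWeight_le i j s₀ q.1]
  have hz : ∫ η, ∑ k, (armCount i j (η k).2 - armWeight i j s₀ (η k).1)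
      ∂(alg.law M (fun _ => s₀) K) = 0 := by
    refine integral_law_sum_eq_zero alg M s₀ hmeas hB (fun π => ?_) K
    obtain ⟨h1, h2⟩ := integral_bandit_episodeKernel_sum i s₀ (armMean j δ)
      (measurable_armIndicator i j) (c := fun a => armIndicator i j (s₀, a))
      (fun a => by ring) π
    have h3 : Integrable (armCount i j) (M.episodeKernel H (π, s₀)) := h1
    have h4 : ∫ e, armCount i j e ∂(M.episodeKernel H (π, s₀)) = armWeight i j s₀ π := h2
    dsimp only
    rw [integral_sub h3 (integrable_const _), h4]
    simp
  have hreg : ∀ η : History F H K, M.regret (fun _ => s₀) η =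
      δ / 2 * ((K * H : ℕ) - totalArmCount i j η) +
        δ / 2 * ∑ k, (armCount i j (η k).2 - armWeight i j s₀ (η k).1) := by
    intro η
    have h1 : ∀ k, M.optValue H s₀ - M.value (η k).1 s₀ = δ / 2 * (H - armCount i j (η k).2) +
        δ / 2 * (armCount i j (η k).2 - armWeight i j s₀ (η k).1) := by
      intro k
      rw [hM, optValue_bandit_armMean, value_bandit_armMean]
      ring
    rw [FMDP.regret, Finset.sum_congr rfl fun k _ => h1 k, Finset.sum_add_distrib,
      ← Finset.mul_sum, ← Finset.mul_sum, Finset.sum_sub_distrib, totalArmCount]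
    simp
  have hI : Integrable
      (fun η : History F H K => ∑ k, (armCount i j (η k).2 - armWeight i j s₀ (η k).1))
      (alg.law M (fun _ => s₀) K) :=
    integrable_finsetSum _ fun k _ => Integrable.of_bound (C := H)
      (hmeas.comp (measurable_pi_apply k)).aestronglyMeasurable (.of_forall fun η => hB _)
  have hT := integrable_totalArmCount i j (alg.law M (fun _ => s₀) K)
  rw [Algorithm.expectedRegret]
  simp only [hreg]
  have hT' : Integrable (fun η : History F H K => ((K * H : ℕ) : ℝ) - totalArmCount i j η)
      (alg.law M (fun _ => s₀) K) := (integrable_const _).sub hT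
  rw [integral_add (hT'.const_mul _) (hI.const_mul _),
    integral_const_mul, integral_const_mul, hz, integral_sub (integrable_const _) hT]
  simp

/-! ### The likelihood ratio of a good arm -/

open scoped Classical in
/-- The likelihood ratio of one step between the bandit with the good arm `j` and the bandit with
uniformly random rewards. -/
def stepRatio (i : Fin F.l) (j : F.Scope (F.actionPart i)) (δ : ℝ) (σ : Step F) : ℝ :=
  if proj (F.actionPart i) σ.1 = j then if σ.2.1 i = 1 then 1 + δ else 1 - δ else 1

theorem measurable_stepRatio (i : Fin F.l) (j : F.Scope (F.actionPart i)) (δ : ℝ) :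
    Measurable (stepRatio i j δ) := by
  classical
  refine Measurable.ite ?_ (Measurable.ite ?_ measurable_const measurable_const) measurable_const
  · exact measurable_fst (MeasurableSet.of_discrete (s := {x | proj (F.actionPart i) x = j}))
  · have h : Measurable fun σ : Step F => σ.2.1 i :=
      (measurable_pi_apply i).comp (measurable_fst.comp measurable_snd)
    exact h (measurableSet_singleton (1 : ℝ))

theorem stepRatio_pos (i : Fin F.l) (j : F.Scope (F.actionPart i)) {δ : ℝ} (h0 : 0 ≤ δ)
    (h1 : δ < 1) (σ : Step F) : 0 < stepRatio i j δ σ := by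
  unfold stepRatio
  split_ifs <;> linarith

theorem abs_log_stepRatio_le (i : Fin F.l) (j : F.Scope (F.actionPart i)) (δ : ℝ) (σ : Step F) :
    |Real.log (stepRatio i j δ σ)| ≤ |Real.log (1 + δ)| + |Real.log (1 - δ)| := by
  have h0 := abs_nonneg (Real.log (1 + δ))
  have h1 := abs_nonneg (Real.log (1 - δ))
  unfold stepRatio
  split_ifs
  · linarith
  · linarith
  · rw [Real.log_one, abs_zero]
    linarith

/-- The likelihood ratio of the record of `K` episodes. -/
def historyRatio (i : Fin F.l) (j : F.Scope (F.actionPart i)) (δ : ℝ) {H K : ℕ}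
    (η : History F H K) : ℝ :=
  ∏ k, ∏ h, stepRatio i j δ ((η k).2 h)

theorem measurable_historyRatio (i : Fin F.l) (j : F.Scope (F.actionPart i)) (δ : ℝ) {H K : ℕ} :
    Measurable (historyRatio i j δ : History F H K → ℝ) :=
  Finset.measurable_prod _ fun k _ => Finset.measurable_prod _ fun h _ =>
    (measurable_stepRatio i j δ).comp
      ((measurable_pi_apply h).comp (measurable_snd.comp (measurable_pi_apply k)))

theorem historyRatio_pos (i : Fin F.l) (j : F.Scope (F.actionPart i)) {δ : ℝ} (h0 : 0 ≤ δ)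
    (h1 : δ < 1) {H K : ℕ} (η : History F H K) : 0 < historyRatio i j δ η :=
  Finset.prod_pos fun _ _ => Finset.prod_pos fun _ _ => stepRatio_pos i j h0 h1 _

theorem log_historyRatio (i : Fin F.l) (j : F.Scope (F.actionPart i)) {δ : ℝ} (h0 : 0 ≤ δ)
    (h1 : δ < 1) {H K : ℕ} (η : History F H K) :
    Real.log (historyRatio i j δ η) = ∑ k, ∑ h, Real.log (stepRatio i j δ ((η k).2 h)) := by
  rw [historyRatio, Real.log_prod fun _ _ =>
    (Finset.prod_pos fun _ _ => stepRatio_pos i j h0 h1 _).ne']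
  exact Finset.sum_congr rfl fun k _ => Real.log_prod fun _ _ => (stepRatio_pos i j h0 h1 _).ne'

/-- At the arm `j` the Bernoulli weights `(1 ± δ) / 2` are compared with `1 / 2`; elsewhere the two
bandits agree. These are the values of `stepRatio` on the possible rewards `1` and `0`. -/
theorem law_bandit_armMean_eq_withDensity (i : Fin F.l) (s₀ : F.State)
    (j : F.Scope (F.actionPart i)) {δ : unitInterval} (hδ : (δ : ℝ) < 1) {H : ℕ}
    (alg : Algorithm F H) (s : ℕ → F.State) (K : ℕ) :
    alg.law (bandit i s₀ (armMean j δ)) s K =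
      (alg.law (bandit i s₀ (armMean j 0)) s K).withDensity
        fun η => ENNReal.ofReal (historyRatio i j δ η) := by
  have hpos := stepRatio_pos i j δ.2.1 hδ
  refine Measure.ext_of_lintegral _ fun f hf => ?_
  rw [lintegral_withDensity_eq_lintegral_mul _ (measurable_historyRatio i j δ).ennreal_ofReal hf,
    lintegral_bandit_law_change i s₀ (p := armMean j δ) (q := armMean j 0)
      (ρ := fun σ => ENNReal.ofReal (stepRatio i j δ σ))
      (measurable_stepRatio i j δ).ennreal_ofReal (fun x a => ?_) (fun x a => ?_) alg s K hf]
  · refine lintegral_congr fun η => ?_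
    rw [Pi.mul_apply, historyRatio, ENNReal.ofReal_prod_of_nonneg fun k _ =>
      Finset.prod_nonneg fun h _ => (hpos _).le]
    congr 1
    exact Finset.prod_congr rfl fun k _ =>
      (ENNReal.ofReal_prod_of_nonneg fun h _ => (hpos _).le).symm
  · rw [← ENNReal.ofReal_mul (hpos _).le, coe_armMean_proj, coe_armMean_proj]
    congr 1
    simp only [stepRatio, armIndicator]
    split_ifs with h1 h2
    · simp; ring
    · simp at h2
    · simp
  · rw [← ENNReal.ofReal_mul (hpos _).le, coe_armMean_proj, coe_armMean_proj]
    congr 1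
    simp only [stepRatio, armIndicator]
    split_ifs with h1 h2
    · simp at h2
    · simp; ring
    · simp

/-- The relative entropy of the laws of the record is proportional to the number of plays of the
good arm. -/
theorem integral_log_historyRatio (i : Fin F.l) (s₀ : F.State) (j : F.Scope (F.actionPart i))
    {δ : ℝ} (h0 : 0 ≤ δ) (h1 : δ < 1) {H : ℕ} (alg : Algorithm F H) (K : ℕ) :
    Integrable (fun η => Real.log (historyRatio i j δ η))
        (alg.law (bandit i s₀ (armMean j 0)) (fun _ => s₀) K) ∧
      ∫ η, -Real.log (historyRatio i j δ η)
          ∂(alg.law (bandit i s₀ (armMean j 0)) (fun _ => s₀) K) =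
        -(Real.log (1 + δ) + Real.log (1 - δ)) / 2 *
          ∫ η, totalArmCount i j η ∂(alg.law (bandit i s₀ (armMean j 0)) (fun _ => s₀) K) := by
  set M := bandit i s₀ (armMean j 0) with hM
  set c := (Real.log (1 + δ) + Real.log (1 - δ)) / 2 with hc
  set B := |Real.log (1 + δ)| + |Real.log (1 - δ)| with hB
  -- Under fair rewards the log-ratio of a step at the arm `j` has mean `c`, and it is `0` at other
  -- arms, so `ψ` is the centred log-ratio.
  let ψ : Step F → ℝ := fun σ => Real.log (stepRatio i j δ σ) - c * armIndicator i j σ.1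
  have hψ : Measurable ψ :=
    (measurable_stepRatio i j δ).log.sub ((measurable_armIndicator i j).const_mul c)
  have hψB : ∀ σ, |ψ σ| ≤ B + |c| := by
    intro σ
    refine (abs_sub _ _).trans (add_le_add (abs_log_stepRatio_le i j δ σ) ?_)
    rw [abs_mul, abs_of_nonneg (armIndicator_nonneg i j _)]
    exact mul_le_of_le_one_right (abs_nonneg c) (armIndicator_le_one i j _)
  have hsum : ∀ q : Policy F H × Episode F H, |∑ h, ψ (q.2 h)| ≤ H * (B + |c|) := by
    intro q
    refine (Finset.abs_sum_le_sum_abs _ _).trans ?_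
    refine (Finset.sum_le_sum fun h _ => hψB (q.2 h)).trans_eq ?_
    rw [Finset.sum_const, Finset.card_univ, Fintype.card_fin, nsmul_eq_mul]
  have hmeas : Measurable fun q : Policy F H × Episode F H => ∑ h, ψ (q.2 h) :=
    Finset.measurable_sum _ fun h _ => hψ.comp ((measurable_pi_apply h).comp measurable_snd)
  have hz : ∫ η, ∑ k, ∑ h, ψ ((η k).2 h) ∂(alg.law M (fun _ => s₀) K) = 0 := by
    refine integral_law_sum_eq_zero alg M s₀ hmeas hsum (fun π => ?_) K
    refine (integral_bandit_episodeKernel_sum i s₀ (armMean j 0) hψ (c := fun _ => 0)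
      (fun a => ?_) π).2.trans (by simp)
    rw [coe_armMean_proj]
    simp only [ψ, stepRatio, armIndicator]
    by_cases h2 : proj (F.actionPart i) (s₀, a) = j
    · simp [h2, hc]
      ring
    · simp [h2]
  have hI : Integrable (fun η : History F H K => ∑ k, ∑ h, ψ ((η k).2 h))
      (alg.law M (fun _ => s₀) K) :=
    integrable_finsetSum _ fun k _ => Integrable.of_bound (C := H * (B + |c|))
      (hmeas.comp (measurable_pi_apply k)).aestronglyMeasurable (.of_forall fun η => hsum _)
  have hN := integrable_totalArmCount i j (alg.law M (fun _ => s₀) K)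
  have heq : ∀ η : History F H K, Real.log (historyRatio i j δ η) =
      ∑ k, ∑ h, ψ ((η k).2 h) + c * totalArmCount i j η := by
    intro η
    rw [log_historyRatio i j h0 h1]
    simp only [ψ, totalArmCount, armCount, Finset.sum_sub_distrib, Finset.mul_sum]
    ring
  simp only [heq]
  refine ⟨hI.add (hN.const_mul c), ?_⟩
  rw [integral_neg, integral_add hI (hN.const_mul c), hz, integral_const_mul]
  ring

/-! ### Choice of the gap and averaging over the arms. -/

/-- The left side is `log ((1 - δ²)⁻¹) / 2`, to which `log x ≤ x - 1` applies; `δ² ≤ 1 / 2` then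
gives `(1 - δ²)⁻¹ ≤ 1 + 2δ²`. -/
theorem neg_log_add_log_div_two_le {δ : ℝ} (h0 : 0 ≤ δ) (h1 : δ ≤ 1 / 2) :
    -(Real.log (1 + δ) + Real.log (1 - δ)) / 2 ≤ δ ^ 2 := by
  have hpos : 0 < 1 - δ ^ 2 := by nlinarith
  rw [← Real.log_mul (by linarith) (by linarith), show (1 + δ) * (1 - δ) = 1 - δ ^ 2 by ring,
    ← Real.log_inv]
  have h2 := Real.log_le_sub_one_of_pos (inv_pos.2 hpos)
  have h3 : (1 - δ ^ 2)⁻¹ ≤ 1 + 2 * δ ^ 2 := by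
    rw [inv_le_iff_one_le_mul₀ hpos]
    nlinarith [mul_nonneg (sq_nonneg δ) (show 0 ≤ 1 - 2 * δ ^ 2 by nlinarith)]
  linarith

/-- If the number of steps is at least the number of arms, then some bandit with one good arm has
large expected regret. -/
theorem exists_le_expectedRegret (i : Fin F.l) (s₀ : F.State)
    (h2 : 2 ≤ F.scopeCard (F.actionPart i)) {H : ℕ} (alg : Algorithm F H) (K : ℕ)
    (hT : F.scopeCard (F.actionPart i) ≤ K * H) :
    ∃ M : FMDP F, 1 / 128 * √((F.scopeCard (F.actionPart i) : ℝ) * ((K * H : ℕ) : ℝ)) ≤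
      alg.expectedRegret M (fun _ => s₀) K := by
  classical
  set A : ℝ := (F.scopeCard (F.actionPart i) : ℝ) with hA
  set T : ℝ := ((K * H : ℕ) : ℝ) with hTdef
  have hcard : (Fintype.card (F.Scope (F.actionPart i)) : ℝ) = A := by
    rw [hA, scopeCard, Nat.card_eq_fintype_card]
  have hA2 : 2 ≤ A := by rw [hA]; exact_mod_cast h2
  have hAT : A ≤ T := by rw [hA, hTdef]; exact_mod_cast hT
  have hTpos : 0 < T := by linarith
  -- At this gap an arm played `T / A` times carries relative entropy at most `d² * T / A = 1 /
  -- 256`: too little to identify it. The assumption `A ≤ T` keeps `d` at most `1 / 16`.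
  set d : ℝ := √(A / T) / 16 with hd
  have hd0 : 0 ≤ d := by positivity
  have hsq : d ^ 2 * T = A / 256 := by
    rw [hd, div_pow, Real.sq_sqrt (by positivity)]
    field_simp
    norm_num
  have hd1 : d ≤ 1 / 16 := by
    have : √(A / T) ≤ 1 := by
      rw [Real.sqrt_le_left zero_le_one, one_pow, div_le_one hTpos]
      exact hAT
    rw [hd]
    linarith
  let δ : unitInterval := ⟨d, hd0, by linarith⟩
  obtain ⟨j₀⟩ : Nonempty (F.Scope (F.actionPart i)) := inferInstance
  set μ := alg.law (bandit i s₀ (armMean j₀ 0)) (fun _ => s₀) K with hμ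
  have hμj : ∀ j, alg.law (bandit i s₀ (armMean j 0)) (fun _ => s₀) K = μ := fun j => by
    rw [hμ, armMean_zero j j₀]
  set N₀ : F.Scope (F.actionPart i) → ℝ := fun j => ∫ η, totalArmCount i j η ∂μ with hN₀
  set N₁ : F.Scope (F.actionPart i) → ℝ := fun j =>
    ∫ η, totalArmCount i j η ∂(alg.law (bandit i s₀ (armMean j δ)) (fun _ => s₀) K) with hN₁
  -- The information inequality with `t = 1 / 16`, so that `1 / (2 * t) = 8` and `2 * t = 1 / 8`,
  -- and with relative entropy at most `d ^ 2 * N₀ j`.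
  have hbound : ∀ j, N₁ j ≤ N₀ j + T * (8 * d ^ 2 * N₀ j + 1 / 8) := by
    intro j
    have hlaw := law_bandit_armMean_eq_withDensity i s₀ j (δ := δ)
      (show d < 1 by linarith) alg (fun _ => s₀) K
    rw [hμj] at hlaw
    have hprob : IsProbabilityMeasure
        (μ.withDensity fun η => ENNReal.ofReal (historyRatio i j d η)) := by
      change IsProbabilityMeasure
        (μ.withDensity fun η => ENNReal.ofReal (historyRatio i j δ η))
      rw [← hlaw]
      infer_instance
    have hent := integral_log_historyRatio i s₀ j hd0 (by linarith) alg K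
    rw [hμj] at hent
    have h := integral_withDensity_le_add_entropy (μ := μ) (measurable_historyRatio i j d)
      (historyRatio_pos i j hd0 (by linarith)) hent.1 (measurable_totalArmCount i j)
      (totalArmCount_nonneg i j) (totalArmCount_le i j) (t := 1 / 16) (by norm_num)
    rw [hent.2, show ∫ η, totalArmCount i j η ∂μ = N₀ j from rfl] at h
    have hN₁j : N₁ j = ∫ η, totalArmCount i j η
        ∂(μ.withDensity fun η => ENNReal.ofReal (historyRatio i j d η)) := by
      rw [hN₁]
      dsimp only
      rw [hlaw]
    rw [hN₁j]
    refine h.trans ?_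
    have hN₀j : 0 ≤ N₀ j := integral_nonneg fun η => totalArmCount_nonneg i j η
    have hkl := mul_le_mul_of_nonneg_right
      (neg_log_add_log_div_two_le hd0 (by linarith : d ≤ 1 / 2)) hN₀j
    gcongr
    · exact (div_le_div_of_nonneg_right hkl (by norm_num)).trans_eq (by ring)
    · norm_num
  have hsum₀ : ∑ j, N₀ j = T := sum_integral_totalArmCount i μ
  -- The sum is at most `T * (1 + A / 32 + A / 8)`. Since `A ≥ 2` gives `1 ≤ A / 2`, this is at most
  -- `21 / 32 * A * T`, below `3 / 4 * A * T`.
  have hsum₁ : ∑ j, N₁ j ≤ ∑ j : F.Scope (F.actionPart i), 3 / 4 * T := by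
    refine (Finset.sum_le_sum fun j _ => hbound j).trans ?_
    rw [Finset.sum_add_distrib, ← Finset.mul_sum, Finset.sum_add_distrib, ← Finset.mul_sum, hsum₀]
    simp only [Finset.sum_const, Finset.card_univ, nsmul_eq_mul, hcard]
    have h3 : 8 * d ^ 2 * T = A / 32 := by rw [mul_assoc, hsq]; ring
    rw [h3]
    nlinarith
  obtain ⟨j, -, hj⟩ := Finset.exists_le_of_sum_le ⟨j₀, Finset.mem_univ _⟩ hsum₁
  refine ⟨bandit i s₀ (armMean j δ), ?_⟩
  rw [expectedRegret_bandit_armMean]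
  have hsqrt : √(A * T) = √(A / T) * T := by
    rw [show A * T = A / T * T ^ 2 by field_simp, Real.sqrt_mul (by positivity),
      Real.sqrt_sq hTpos.le]
  have hd' : √(A / T) = 16 * d := by rw [hd]; ring
  rw [hsqrt, hd']
  -- As `N₁ j ≤ 3 / 4 * T`, the right side is at least `d * T / 8`, which equals `1 / 128 * (16 * d
  -- * T)`; this fixes the constant.
  change _ ≤ d / 2 * (T - N₁ j)
  nlinarith

end FactoredMDP

end

/-! ### The lower bound for a general structure. -/

theorem mainTheorem6 :
    ∃ c : ℝ, 0 < c ∧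
      ∀ (F : FactoredMDP.NormalStructure.{u}) (H : ℕ) (alg : FactoredMDP.Algorithm F H) (K : ℕ),
        (∀ i, ∀ j ∈ F.transScope i, j.isLeft = true) →
        (∃ i, 2 ≤ F.scopeCard (F.actionPart i)) →
        (∀ i, F.scopeCard (F.actionPart i) ≤ K * H) →
        ∃ (M : FactoredMDP.FMDP F) (s : ℕ → F.State),
          c * ⨆ i, √((F.scopeCard (F.actionPart i) : ℝ) * ((K * H : ℕ) : ℝ)) ≤
            alg.expectedRegret M s K := by
  refine ⟨1 / 128, by norm_num, fun F H alg K _ h2 hT => ?_⟩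
  obtain ⟨i₁, hi₁⟩ := h2
  have : Nonempty (Fin F.l) := ⟨i₁⟩
  -- The supremum over reward factors is attained at the one with the most arms, so a bandit on this
  -- factor suffices.
  obtain ⟨i, hi⟩ := Finite.exists_max fun i => F.scopeCard (F.actionPart i)
  obtain ⟨s₀⟩ : Nonempty F.State := inferInstance
  obtain ⟨M, hM⟩ := FactoredMDP.exists_le_expectedRegret i s₀ (hi₁.trans (hi i₁)) alg K (hT i)
  refine ⟨M, fun _ => s₀, le_trans ?_ hM⟩
  gcongr
  refine ciSup_le fun i' => ?_
  gcongr
  exact hi i'
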